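/- A word $w$ contains a pattern $P$ if nonempty words can be substituted for the letters of $P$ so that the resulting word is a subword (a block of consecutive letters) of $w$. The Zimin words are defined by $Z_1=x_1$ and $Z_n=Z_{n-1}x_nZ_{n-1}$ for $n\ge 2$, where $x_1,x_2,\dots$ are distinct letters. Let $f(n,q)$ be the least integer such that every word of length $f(n,q)$ over an alphabet of size $q$ contains $Z_n$. For a real number $x$, define $T_1(q,x)=x$ and $T_{k+1}(q,x)=q^{T_k(q,x)}$ for $k\ge 1$, so that $T_k(q,x)=q^{q^{\cdot^{\cdot^{\cdot^{q^{x}}}}}}$ is a tower of height $k$ with top exponent $x$. **Theorem.** For every fixed integer $n\ge 3$, $$f(n,q)\ \ge\ T_{n-1}\bigl(q,\;q-o(q)\bigr)\qquad (q\to\infty).$$ That is, for each $n\ge 3$ there is a function $e_n:\mathbb{N}\to\mathbb{R}$ with $e_n(q)/q\to 0$ as $q\to\infty$ such that $f(n,q)\ge T_{n-1}(q,\,q-e_n(q))$ for all sufficiently large integers $q$. In particular, $f(3,q)\ge q^{q-o(q)}$. -/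

import Mathlib

namespace ZiminWords

/-- The word `w` contains the pattern `P`: nonempty words can be substituted for the letters of `P`
so that the result is a subword (a block of consecutive letters) of `w`. -/
def Contains {α β : Type*} (w : List α) (P : List β) : Prop :=
  ∃ σ : β → List α, (∀ b ∈ P, σ b ≠ []) ∧ P.flatMap σ <:+: w

/-- The Zimin words over the letters `0, 1, 2, …`: `Z_1 = 0`, `Z_2 = 010`, `Z_3 = 0102010`, and
`Z_{n+1} = Z_n n Z_n`. The letter `n` is new, since `Z_n` only uses letters below `n`. -/
def zimin : ℕ → List ℕ
  | 0 => []
  | n + 1 => zimin n ++ [n] ++ zimin n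

/-- `f n q` is the least `L` such that every word of length `L` over an alphabet of size `q`
contains the Zimin word `Z_n`. (It would be `0` if there were no such `L`.) -/
noncomputable def f (n q : ℕ) : ℕ :=
  sInf {L : ℕ | ∀ w : List (Fin q), w.length = L → Contains w (zimin n)}

/-- `tower b x k` is the tower `b ^ b ^ ⋯ ^ b ^ x` of height `k`: there are `k` levels in total,
the top one is `x` and the other `k - 1` are `b`. The empty tower is `1`. -/
noncomputable def tower (b x : ℝ) : ℕ → ℝ
  | 0 => 1
  | 1 => x
  | k + 2 => b ^ tower b x (k + 1)

end ZiminWords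

/-! An instance of Z_{n+1} begins and ends with disjoint copies of one instance of Z_n. It is
therefore long as soon as equal blocks of that length are forced far apart, and it suffices to build
an infinite word in which all instances of Z_n are long.

For n = 3, take r + 2b letters. A counting argument (`mul_card_separatedWords_le`) gives words in
which any r + 1 consecutive letters are distinct and equal blocks of length r + 1 are at distance at
least b^(r+1). Distinctness makes instances of Z_2 longer than r, so instances of Z_3 have length at
least b^(r+1).

To raise n by one, replace 2b distinguished letters (later, their copies) by four copies each, so
that they carry a binary counter (`two_pow_le_of_occursAt_relabel`). They occur in every window of
length r + 1, so an instance of Z_n of length at least M displays about M/(r+1) labels; this pins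
down the counter modulo 2^c with c about M/(2(r+1)), and the next repetition is at distance at least
2^c.

With b about q / log q and n fixed, r = q - o(q) and log b ~ log q, so b^(r+1) = q^(q-o(q)). Each
counter step costs only 3 in the top exponent of the tower. -/

namespace ZiminWords

/-! ### Instances of Zimin words in infinite words; unavoidability -/

/-- The block of length `l` of the infinite word `W` starting at position `i` is an instance of
the Zimin word `Z_n`. -/
def OccursAt {α : Type*} (W : ℕ → α) : ℕ → ℕ → ℕ → Prop
  | 0, _, l => l = 0
  | n + 1, i, l => ∃ m, OccursAt W n i m ∧ 2 * m + 1 ≤ l ∧ ∀ k < m, W (i + k) = W (i + (l - m) + k)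

theorem OccursAt.comp {α β : Type*} {W : ℕ → α} (π : α → β) {n : ℕ} :
    ∀ {i l : ℕ}, OccursAt W n i l → OccursAt (fun k => π (W k)) n i l := by
  induction n with
  | zero => exact fun h => h
  | succ n ih =>
    rintro i l ⟨m, h, hl, hk⟩
    exact ⟨m, ih h, hl, fun k hkm => congrArg π (hk k hkm)⟩

theorem occursAt_flatMap {α : Type*} (W : ℕ → α) (σ : ℕ → List α) (i n : ℕ)
    (hσ : ∀ b ∈ zimin n, σ b ≠ [])
    (hW : ∀ k (hk : k < ((zimin n).flatMap σ).length), ((zimin n).flatMap σ)[k] = W (i + k)) :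
    OccursAt W n i ((zimin n).flatMap σ).length := by
  induction n with
  | zero => simp [zimin, OccursAt]
  | succ n ih =>
    have hz : (zimin (n + 1)).flatMap σ =
        (zimin n).flatMap σ ++ (σ n ++ (zimin n).flatMap σ) := by
      simp [zimin, List.flatMap_append]
    have hn : 0 < (σ n).length := List.length_pos_iff.2 (hσ n (by simp [zimin]))
    have hσ' : ∀ b ∈ zimin n, σ b ≠ [] := fun b hb => hσ b (by simp [zimin, hb])
    generalize (zimin (n + 1)).flatMap σ = v at hz hW
    generalize (zimin n).flatMap σ = u at *
    subst hz
    have hW1 : ∀ k (hk : k < u.length), u[k] = W (i + k) := by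
      intro k hk
      have := hW k (by simp; omega)
      rwa [List.getElem_append_left hk] at this
    refine ⟨u.length, ih hσ' hW1, by simp; omega, fun k hk => ?_⟩
    have h2 := hW (u.length + (σ n).length + k) (by simp; omega)
    rw [List.getElem_append_right (by omega), List.getElem_append_right (by omega)] at h2
    rw [← hW1 k hk]
    have e1 : i + ((u ++ (σ n ++ u)).length - u.length) + k =
        i + (u.length + (σ n).length + k) := by
      simp; omega
    rw [e1, ← h2]
    congr 1
    omega

theorem le_length_of_contains {α : Type*} {W : ℕ → α} {n M L : ℕ}
    (hM : ∀ i l, OccursAt W n i l → M ≤ l)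
    (h : Contains (List.ofFn fun k : Fin L => W k) (zimin n)) : M ≤ L := by
  obtain ⟨σ, hσ, s, t, hst⟩ := h
  have hlen := congrArg List.length hst
  simp only [List.length_append, List.length_ofFn] at hlen
  refine (hM s.length _ (occursAt_flatMap W σ s.length n hσ fun k hk => ?_)).trans
    (by omega)
  have h1 : (s ++ (zimin n).flatMap σ ++ t)[s.length + k]'(by
      rw [List.length_append, List.length_append]; omega) = W (s.length + k) := by
    simp only [hst, List.getElem_ofFn]
  rw [← h1, List.getElem_append_left (by rw [List.length_append]; omega), List.getElem_append_right (by omega)]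
  congr 1
  omega

theorem lt_of_mem_zimin {n b : ℕ} (h : b ∈ zimin n) : b < n := by
  induction n with
  | zero => simp [zimin] at h
  | succ n ih =>
    simp only [zimin, List.append_assoc, List.mem_append, List.mem_singleton] at h
    rcases h with h | h | h
    · exact (ih h).trans n.lt_succ_self
    · omega
    · exact (ih h).trans n.lt_succ_self

/-- Zimin words are unavoidable. -/
theorem exists_forall_contains_zimin (q n : ℕ) :
    ∃ L, ∀ w : List (Fin q), w.length = L → Contains w (zimin n) := by
  induction n with
  | zero => exact ⟨0, fun w _ => ⟨fun _ => [], by simp [zimin], by simp [zimin]⟩⟩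
  | succ n ih =>
    obtain ⟨L, hL⟩ := ih
    -- There are q^L + 1 blocks of length L, so two agree; the stride L + 1 leaves a nonempty gap
    -- between them.
    refine ⟨(L + 1) * (q ^ L + 1), fun w hw => ?_⟩
    have hfit : ∀ t : Fin (q ^ L + 1), (L + 1) * t + L < w.length := by
      intro t
      have : (L + 1) * ((t : ℕ) + 1) ≤ (L + 1) * (q ^ L + 1) := Nat.mul_le_mul_left _ t.2
      rw [mul_add] at this
      omega
    obtain ⟨x, y, hxy, he⟩ := Fintype.exists_ne_map_eq_of_card_lt
      (fun (t : Fin (q ^ L + 1)) (k : Fin L) => w[(L + 1) * t + k]'(by have := hfit t; omega))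
      (by simp)
    wlog hlt : x < y generalizing x y
    · exact this y x hxy.symm he.symm (lt_of_le_of_ne (not_lt.1 hlt) hxy.symm)
    set i := (L + 1) * (x : ℕ) with hi
    set j := (L + 1) * (y : ℕ) with hj
    have hij : i + L < j := by
      have : (L + 1) * ((x : ℕ) + 1) ≤ (L + 1) * y := Nat.mul_le_mul_left _ hlt
      rw [mul_add] at this
      omega
    have hjw : j + L < w.length := hfit y
    set u := (w.drop i).take L with hu
    have hul : u.length = L := by simp [hu]; omega
    have huj : (w.drop j).take L = u := by
      apply List.ext_getElem
      · simp [hu]; omega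
      · intro k h1 h2
        have := congrFun he ⟨k, by omega⟩
        simp only [hu, List.getElem_take, List.getElem_drop]
        exact this.symm
    set v := (w.drop (i + L)).take (j - (i + L)) with hv
    have hvne : v ≠ [] := by
      rw [← List.length_pos_iff]; simp [hv]; omega
    have hw' : w = w.take i ++ (u ++ (v ++ (u ++ w.drop (j + L)))) := by
      have e1 : w.drop j = u ++ w.drop (j + L) := by
        rw [← huj, ← List.drop_drop, List.take_append_drop]
      have e2 : w.drop (i + L) = v ++ w.drop j := by
        have := List.take_append_drop (j - (i + L)) (w.drop (i + L))
        rw [List.drop_drop, Nat.add_sub_cancel' hij.le] at this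
        exact this.symm
      have e3 : w.drop i = u ++ w.drop (i + L) := by
        rw [hu, ← List.drop_drop, List.take_append_drop]
      rw [← e1, ← e2, ← e3, List.take_append_drop]
    obtain ⟨σ, hσ, a, c, hac⟩ := hL u hul
    -- If u = a z c with z the instance of Z_n, then u v u = a z (c v a) z c.
    refine ⟨Function.update σ n (c ++ v ++ a), ?_, ?_⟩
    · intro b hb
      by_cases hbn : b = n
      · subst hbn; simp [hvne]
      · rw [Function.update_of_ne hbn]
        simp only [zimin, List.append_assoc, List.mem_append, List.mem_singleton] at hb
        rcases hb with hb | hb | hb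
        · exact hσ b hb
        · exact absurd hb hbn
        · exact hσ b hb
    · have hz : (zimin n).flatMap (Function.update σ n (c ++ v ++ a)) = (zimin n).flatMap σ :=
        List.flatMap_congr fun b hb => Function.update_of_ne (lt_of_mem_zimin hb).ne _ _
      refine ⟨w.take i ++ a, c ++ w.drop (j + L), ?_⟩
      conv_rhs => rw [hw', ← hac]
      rw [zimin, List.flatMap_append, List.flatMap_append, hz, List.flatMap_singleton,
        Function.update_self]
      simp only [List.append_assoc]

/-- Unavoidability is essential: the infimum of the empty set is 0, and no lower bound would follow.
-/
theorem le_f {q n M : ℕ} {W : ℕ → Fin q} (hM : ∀ i l, OccursAt W n i l → M ≤ l) :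
    M ≤ f n q :=
  le_csInf (exists_forall_contains_zimin q n) fun _ hL =>
    le_length_of_contains hM (hL _ (List.length_ofFn))

/-! ### The binary counter: from Z_n to Z_{n+1} -/

/-- A labelling of the positions: the starting points of blocks of length `m` are marked, and each
block spells the last `m` binary digits of its index. -/
def counterLabel (m i : ℕ) : Bool × Bool := (i % m == 0, (i / m).testBit (i % m))

/-- A window of 2m positions contains a complete counter block. The marks align it with a block of
the other window, and equal digits make the two block indices congruent modulo 2^m. -/
theorem two_pow_le_of_counterLabel_eq {m x y : ℕ} (hm : 0 < m) (hxy : x < y)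
    (h : ∀ e < 2 * m, counterLabel m (x + e) = counterLabel m (y + e)) : 2 ^ m ≤ y - x := by
  simp only [counterLabel, Prod.mk.injEq] at h
  obtain ⟨e, he, u, hu⟩ : ∃ e < m + 1, ∃ u, x + e = m * u := by
    refine ⟨m - x % m, by omega, x / m + 1, ?_⟩
    have := Nat.div_add_mod x m
    have := Nat.mod_lt x hm
    rw [mul_add]; omega
  obtain ⟨v, hv⟩ : ∃ v, y + e = m * v := by
    have h1 := (h e (by omega)).1
    rw [hu] at h1
    have h2 : (y + e) % m = 0 := by simpa using h1.symm
    exact (Nat.dvd_of_mod_eq_zero h2)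
  have huv : u < v := by
    by_contra hc
    have := Nat.mul_le_mul_left m (not_lt.1 hc)
    omega
  have hmod : u % 2 ^ m = v % 2 ^ m := by
    apply Nat.eq_of_testBit_eq
    intro k
    rw [Nat.testBit_mod_two_pow, Nat.testBit_mod_two_pow]
    by_cases hk : k < m
    · by_cases hek : e + k < 2 * m
      · have h1 := (h (e + k) hek).2
        rw [← add_assoc, ← add_assoc, hu, hv] at h1
        simp only [Nat.mul_add_mod, Nat.mul_add_div hm, Nat.mod_eq_of_lt hk,
          Nat.div_eq_of_lt hk, add_zero] at h1
        rw [h1]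
      · omega
    · simp [hk]
  have h3 : 2 ^ m ∣ v - u := (Nat.modEq_iff_dvd' huv.le).1 hmod
  have h4 := Nat.le_of_dvd (by omega) h3
  have h5 : v - u ≤ m * (v - u) := Nat.le_mul_of_pos_left _ hm
  have h6 : m * (v - u) = y - x := by rw [Nat.mul_sub, ← hu, ← hv]; omega
  omega

theorem le_count_of_forall_window {p : ℕ → Prop} [DecidablePred p] {g : ℕ}
    (hg : ∀ i, ∃ k < g, p (i + k)) (c : ℕ) : ∀ i, c ≤ Nat.count (fun k => p (i + k)) (g * c) := by
  induction c with
  | zero => simp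
  | succ c ih =>
    intro i
    rw [mul_add, mul_one, Nat.count_add]
    have h1 : 0 < Nat.count (fun k => p (i + (g * c + k))) g := by
      obtain ⟨k, hk, hp⟩ := hg (i + g * c)
      rw [Nat.count_eq_card_filter_range, Finset.card_pos]
      exact ⟨k, by simp [hk, ← add_assoc, hp]⟩
    have := ih i
    omega

theorem count_congr_lt {p r : ℕ → Prop} [DecidablePred p] [DecidablePred r] {n : ℕ}
    (h : ∀ k < n, (p k ↔ r k)) : Nat.count p n = Nat.count r n := by
  rw [Nat.count_eq_card_filter_range, Nat.count_eq_card_filter_range]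
  congr 1
  exact Finset.filter_congr fun k hk => h k (Finset.mem_range.1 hk)

/-- Some infinite word over `r + s` letters has one of the `s` distinguished letters in each block
of length `g`, and all its instances of `Z_n` have length at least `M`. -/
def HasSparseWord (r s n M g : ℕ) : Prop :=
  ∃ W : ℕ → Fin r ⊕ Fin s, (∀ i, ∃ k < g, (W (i + k)).isRight) ∧
    ∀ i l, OccursAt W n i l → M ≤ l

/-- Attach to each distinguished letter a label depending on its rank. -/
def relabel {α β γ : Type*} (W : ℕ → α ⊕ β) (lab : ℕ → γ) (i : ℕ) : α ⊕ (β × γ) :=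
  (W i).map id fun b => (b, lab (Nat.count (fun k => (W k).isRight) i))

/-- The two copies of the inner instance have distinguished letters at the same places. Their ranks
thus differ by a constant, so the counter repeats along 2c consecutive ranks, and a difference of
ranks is at most a difference of positions. -/
theorem two_pow_le_of_occursAt_relabel {α β : Type*} {W : ℕ → α ⊕ β} {n M g : ℕ}
    (hg : ∀ i, ∃ k < g, (W (i + k)).isRight) (hM : ∀ i l, OccursAt W n i l → M ≤ l) (i l : ℕ)
    (h : OccursAt (relabel W (counterLabel (M / g / 2))) (n + 1) i l) : 2 ^ (M / g / 2) ≤ l := by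
  obtain ⟨m, hm, hl, hk⟩ := h
  set c := M / g / 2 with hc
  rcases Nat.eq_zero_or_pos c with hc0 | hc0
  · rw [hc0]; simp; omega
  set p : ℕ → Prop := fun k => (W k).isRight with hp
  -- Erasing the labels leaves an instance of Z_n in `W`.
  have hMm : M ≤ m := by
    refine hM i m ?_
    have := hm.comp (Sum.map id Prod.fst)
    convert this using 2 with k
    rcases hWk : W k with a | b <;> simp [relabel, hWk]
  set j := i + (l - m) with hj
  have hshape : ∀ k < m, (p (i + k) ↔ p (j + k)) := by
    intro k hkm
    have := congrArg Sum.isRight (hk k hkm)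
    simp only [relabel, Sum.isRight_map] at this
    simp only [hp, this]
  have hcount : 2 * c ≤ Nat.count (fun k => p (i + k)) m := by
    refine (le_count_of_forall_window (p := p) hg (2 * c) i).trans (Nat.count_monotone _ ?_)
    calc g * (2 * c) ≤ g * (M / g) := Nat.mul_le_mul_left _ (by omega)
      _ ≤ M := Nat.mul_div_le M g
      _ ≤ m := hMm
  have hinf : {k | p k}.Infinite := by
    rw [Set.infinite_iff_exists_gt]
    intro a
    obtain ⟨k, -, hk⟩ := hg (a + 1)
    exact ⟨a + 1 + k, hk, by omega⟩
  have hcim : Nat.count p (i + m) = Nat.count p i + Nat.count (fun k => p (i + k)) m :=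
    Nat.count_add p i m
  have hcij : Nat.count p (i + m) ≤ Nat.count p j := Nat.count_monotone _ (by omega)
  have hlab : ∀ e < 2 * c,
      counterLabel c (Nat.count p i + e) = counterLabel c (Nat.count p j + e) := by
    intro e he
    -- The position, in the first copy, of its distinguished letter number e, counted from 0.
    set t := Nat.nth p (Nat.count p i + e) with ht
    have hpt : p t := Nat.nth_mem_of_infinite hinf _
    have hct : Nat.count p t = Nat.count p i + e := Nat.count_nth_of_infinite hinf _
    have hti : i ≤ t := by
      by_contra hlt
      have := Nat.count_strict_mono hpt (not_le.1 hlt)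
      omega
    have htm : t < i + m := by
      by_contra hlt
      have := Nat.count_monotone p (not_lt.1 hlt)
      omega
    clear_value t
    obtain ⟨k, rfl⟩ : ∃ k, t = i + k := ⟨t - i, by omega⟩
    have hkm : k < m := by omega
    have hcjk : Nat.count p (j + k) = Nat.count p j + e := by
      rw [Nat.count_add]
      rw [Nat.count_add, add_right_inj] at hct
      rw [← hct]
      congr 1
      exact count_congr_lt fun k' hk' => (hshape k' (hk'.trans hkm)).symm
    have hpj : p (j + k) := (hshape k hkm).1 hpt
    have hW := hk k hkm
    obtain ⟨b, hb⟩ := Sum.isRight_iff.1 hpt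
    obtain ⟨b', hb'⟩ := Sum.isRight_iff.1 hpj
    simp only [relabel, hb, hb', Sum.map_inr, Sum.inr.injEq, Prod.mk.injEq] at hW
    have h2 := hW.2
    change counterLabel c (Nat.count p (i + k)) = counterLabel c (Nat.count p (j + k)) at h2
    rwa [hct, hcjk] at h2
  have h1 := two_pow_le_of_counterLabel_eq hc0 (by omega) hlab
  have h2 : Nat.count p j ≤ Nat.count p i + (l - m) := by
    rw [hj, Nat.count_add]
    exact Nat.add_le_add_left (Nat.count_le _) _
  omega

theorem HasSparseWord.succ {r s n M g : ℕ} (h : HasSparseWord r s n M g) :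
    HasSparseWord r (s * 4) (n + 1) (2 ^ (M / g / 2)) g := by
  obtain ⟨W, hg, hM⟩ := h
  have φ : Fin s × (Bool × Bool) ≃ Fin (s * 4) := Fintype.equivFinOfCardEq (by simp)
  refine ⟨fun i => (relabel W (counterLabel (M / g / 2)) i).map id φ, fun i => ?_,
    fun i l h => ?_⟩
  · obtain ⟨k, hk, hW⟩ := hg i
    exact ⟨k, hk, by simpa [relabel] using hW⟩
  · refine two_pow_le_of_occursAt_relabel hg hM i l ?_
    have := h.comp (Sum.map id φ.symm)
    simpa using this

/-! ### Counting words with separated repetitions -/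

open Classical in
/-- Words of length `L`, written with the last letter first, in which `r + 1` consecutive letters
are distinct and equal blocks of length `r + 1` are at distance at least `N`. -/
noncomputable def separatedWords (A : Type*) [Fintype A] (r N : ℕ) : ℕ → Finset (List A)
  | 0 => {[]}
  | L + 1 => (((separatedWords A r N L).sigma
      fun w => Finset.univ \ (w.take r).toFinset).image fun x => x.2 :: x.1).filter fun x =>
        ∀ p ∈ Finset.Ico 1 N, p + (r + 1) ≤ L + 1 → x.take (r + 1) ≠ (x.drop p).take (r + 1)

section
variable {A : Type*} [Fintype A] {r N : ℕ}

theorem mem_separatedWords_succ {L : ℕ} {x : List A} :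
    x ∈ separatedWords A r N (L + 1) ↔ (∃ w ∈ separatedWords A r N L, ∃ c ∉ w.take r, c :: w = x) ∧
      ∀ p ∈ Finset.Ico 1 N, p + (r + 1) ≤ L + 1 → x.take (r + 1) ≠ (x.drop p).take (r + 1) := by
  classical
  simp only [separatedWords, Finset.mem_filter, Finset.mem_image, Finset.mem_sigma,
    Finset.mem_sdiff, Finset.mem_univ, true_and, List.mem_toFinset, Sigma.exists]
  refine and_congr_left fun _ => ⟨?_, ?_⟩
  · rintro ⟨w, c, ⟨hw, hc⟩, h⟩; exact ⟨w, hw, c, hc, h⟩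
  · rintro ⟨w, hw, c, hc, h⟩; exact ⟨w, c, ⟨hw, hc⟩, h⟩

theorem tail_mem_separatedWords {L : ℕ} {c : A} {w : List A}
    (h : c :: w ∈ separatedWords A r N (L + 1)) : w ∈ separatedWords A r N L ∧ c ∉ w.take r := by
  obtain ⟨⟨w', hw', c', hc', he⟩, -⟩ := mem_separatedWords_succ.1 h
  obtain ⟨rfl, rfl⟩ := List.cons.inj he
  exact ⟨hw', hc'⟩

theorem length_of_mem_separatedWords {L : ℕ} {x : List A}
    (h : x ∈ separatedWords A r N L) : x.length = L := by
  induction L generalizing x with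
  | zero => simp [separatedWords] at h; simp [h]
  | succ L ih =>
    obtain ⟨⟨w, hw, c, -, rfl⟩, -⟩ := mem_separatedWords_succ.1 h
    simp [ih hw]

theorem drop_mem_separatedWords {L : ℕ} (k : ℕ) {x : List A}
    (h : x ∈ separatedWords A r N (k + L)) : x.drop k ∈ separatedWords A r N L := by
  induction k generalizing x with
  | zero => simpa using h
  | succ k ih =>
    rw [show k + 1 + L = k + L + 1 by omega] at h
    obtain ⟨⟨w, hw, c, -, rfl⟩, -⟩ := mem_separatedWords_succ.1 h
    exact ih hw

/-- A list is determined by its tail after position `d` and a shift under which its first `d`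
letters repeat. -/
theorem eq_of_drop_eq_of_take_eq_take_drop {B : Type*} {x x' : List B} {d p : ℕ} (hp : 1 ≤ p)
    (hlen : x.length = x'.length) (hpd : p + d ≤ x.length) (hdrop : x.drop d = x'.drop d)
    (hx : x.take d = (x.drop p).take d) (hx' : x'.take d = (x'.drop p).take d) : x = x' := by
  -- Induction on the distance to the end of the list: as p ≥ 1, the shift moves towards the known
  -- tail, even when the two blocks overlap.
  have key : ∀ m k, x.length - k ≤ m → x[k]? = x'[k]? := by
    intro m
    induction m with
    | zero =>
      intro k hk
      rw [List.getElem?_eq_none (by omega), List.getElem?_eq_none (by omega)]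
    | succ m ih =>
      intro k hk
      by_cases hkd : k < d
      · have h1 := congrArg (·[k]?) hx
        have h2 := congrArg (·[k]?) hx'
        simp only [List.getElem?_take, hkd, if_true, List.getElem?_drop] at h1 h2
        rw [h1, h2]
        exact ih _ (by omega)
      · have h1 := congrArg (·[k - d]?) hdrop
        simp only [List.getElem?_drop] at h1
        rwa [Nat.add_sub_cancel' (by omega)] at h1
  exact List.ext_getElem? fun k => key _ k le_rfl

/-- Let c_L count the words of length L. Each has at least 2b extensions by a letter distinct from
the last r. A failing extension repeats its last r + 1 letters at a distance p < b^(r+1), and is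
determined by p and the word without these letters. So each p spoils at most c_{L-r} extensions,
which by induction is at most c_L / b^r; in total at most b c_L fail. -/
theorem mul_card_separatedWords_le {b : ℕ} (hA : Fintype.card A = r + 2 * b) (L : ℕ) :
    b * (separatedWords A r (b ^ (r + 1)) L).card ≤
      (separatedWords A r (b ^ (r + 1)) (L + 1)).card := by
  classical
  induction L using Nat.strong_induction_on with
  | _ L ih =>
  set N := b ^ (r + 1) with hN
  set C := separatedWords A r N with hC
  set E := ((C L).sigma fun w => Finset.univ \ (w.take r).toFinset).image
    fun x => x.2 :: x.1 with hE
  have hEcard : 2 * b * (C L).card ≤ E.card := by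
    rw [hE, Finset.card_image_of_injective, Finset.card_sigma, mul_comm, ← smul_eq_mul]
    · refine Finset.card_nsmul_le_sum _ _ _ fun w _ => ?_
      have h1 := Finset.le_card_sdiff (w.take r).toFinset Finset.univ
      have h2 := List.toFinset_card_le (w.take r)
      have h3 := List.length_take_le r w
      rw [Finset.card_univ, hA] at h1
      omega
    · rintro ⟨w, c⟩ ⟨w', c'⟩ h
      obtain ⟨rfl, rfl⟩ := List.cons.inj h
      rfl
  set bad : ℕ → Finset (List A) := fun p => E.filter fun x =>
    p + (r + 1) ≤ L + 1 ∧ x.take (r + 1) = (x.drop p).take (r + 1) with hbad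
  have hmemE' : ∀ x ∈ E, ∃ w ∈ C L, ∃ c ∉ w.take r, c :: w = x := by
    intro x hx
    simp only [hE, Finset.mem_image, Finset.mem_sigma, Finset.mem_sdiff, Finset.mem_univ,
      true_and, List.mem_toFinset, Sigma.exists] at hx
    obtain ⟨w, c, ⟨hw, hc⟩, h⟩ := hx
    exact ⟨w, hw, c, hc, h⟩
  have hmemE : ∀ x ∈ E, x.length = L + 1 ∧ x.drop 1 ∈ C L := by
    intro x hx
    obtain ⟨w, hw, c, -, rfl⟩ := hmemE' x hx
    exact ⟨by simp [length_of_mem_separatedWords hw], by simpa using hw⟩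
  have hcover : E ⊆ C (L + 1) ∪ (Finset.Ico 1 N).biUnion bad := by
    intro x hx
    by_cases hxb : x ∈ (Finset.Ico 1 N).biUnion bad
    · exact Finset.mem_union_right _ hxb
    · refine Finset.mem_union_left _ 
        (mem_separatedWords_succ.2 ⟨hmemE' x hx, fun p hp hpl he => hxb ?_⟩)
      exact Finset.mem_biUnion.2 ⟨p, hp, Finset.mem_filter.2 ⟨hx, hpl, he⟩⟩
  have hbadcard : ((Finset.Ico 1 N).biUnion bad).card ≤ b * (C L).card := by
    by_cases hrL : r ≤ L
    · have hpow : ∀ k ≤ r, b ^ k * (C (L - r)).card ≤ (C (L - r + k)).card := by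
        intro k
        induction k with
        | zero => simp
        | succ k ihk =>
          intro hk
          calc b ^ (k + 1) * (C (L - r)).card = b * (b ^ k * (C (L - r)).card) := by ring
            _ ≤ b * (C (L - r + k)).card := Nat.mul_le_mul_left _ (ihk (by omega))
            _ ≤ _ := ih (L - r + k) (by omega)
      have hpr := hpow r le_rfl
      rw [Nat.sub_add_cancel hrL] at hpr
      have hone : ∀ p ∈ Finset.Ico 1 N, (bad p).card ≤ (C (L - r)).card := by
        intro p hp
        refine Finset.card_le_card_of_injOn (List.drop (r + 1)) (fun x hx => ?_)
          fun x hx x' hx' h => ?_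
        · have h1 := (hmemE x (Finset.mem_filter.1 hx).1).2
          rw [show L = r + (L - r) by omega] at h1
          have := drop_mem_separatedWords r h1
          rwa [List.drop_drop, add_comm] at this
        · obtain ⟨h1, h2, h3⟩ := Finset.mem_filter.1 hx
          obtain ⟨h1', -, h3'⟩ := Finset.mem_filter.1 hx'
          exact eq_of_drop_eq_of_take_eq_take_drop (Finset.mem_Ico.1 hp).1
            ((hmemE x h1).1.trans (hmemE x' h1').1.symm) (by rw [(hmemE x h1).1]; exact h2) h h3 h3'
      calc ((Finset.Ico 1 N).biUnion bad).card
          ≤ (Finset.Ico 1 N).card * (C (L - r)).card := Finset.card_biUnion_le_card_mul _ _ _ hone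
        _ ≤ N * (C (L - r)).card := Nat.mul_le_mul_right _ (by simp)
        _ = b * (b ^ r * (C (L - r)).card) := by rw [hN]; ring
        _ ≤ b * (C L).card := Nat.mul_le_mul_left _ hpr
    -- For L < r there is no room for an earlier block of length r + 1.
    · refine (Finset.card_biUnion_le_card_mul _ _ 0 fun p _ => ?_).trans (by simp)
      rw [Nat.le_zero, Finset.card_eq_zero]
      exact Finset.filter_eq_empty_iff.2 fun x _ h => by omega
  have h1 := (Finset.card_le_card hcover).trans (Finset.card_union_le _ _)
  have h2 : 2 * b * (C L).card = b * (C L).card + b * (C L).card := by ring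
  omega

theorem separatedWords_nonempty {b : ℕ} (hb : 0 < b) (hA : Fintype.card A = r + 2 * b) (L : ℕ) :
    (separatedWords A r (b ^ (r + 1)) L).Nonempty := by
  induction L with
  | zero => simp [separatedWords]
  | succ L ih =>
    exact Finset.card_pos.1 ((Nat.mul_pos hb (Finset.card_pos.2 ih)).trans_le
      (mul_card_separatedWords_le hA L))

end

/-! ### Passage to an infinite word and the case n = 3 -/

/-- The first letters of an infinite word, in reverse order. -/
def revPrefix {A : Type*} (W : ℕ → A) : ℕ → List A
  | 0 => []
  | L + 1 => W L :: revPrefix W L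

theorem length_revPrefix {A : Type*} (W : ℕ → A) (L : ℕ) : (revPrefix W L).length = L := by
  induction L with
  | zero => rfl
  | succ L ih => simp [revPrefix, ih]

theorem getElem?_revPrefix {A : Type*} (W : ℕ → A) {L k : ℕ} (h : k < L) :
    (revPrefix W L)[L - 1 - k]? = some (W k) := by
  induction L with
  | zero => omega
  | succ L ih =>
    by_cases hk : k = L
    · subst hk; simp [revPrefix]
    · have := ih (by omega)
      rw [show L + 1 - 1 - k = (L - 1 - k) + 1 by omega, revPrefix, List.getElem?_cons_succ, this]

theorem drop_revPrefix {A : Type*} (W : ℕ → A) (p L : ℕ) :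
    (revPrefix W (p + L)).drop p = revPrefix W L := by
  induction p with
  | zero => simp
  | succ p ih => rw [show p + 1 + L = p + L + 1 by omega, revPrefix, List.drop_succ_cons, ih]

theorem revPrefix_congr {A : Type*} {W W' : ℕ → A} {L : ℕ} (h : ∀ k < L, W k = W' k) :
    revPrefix W L = revPrefix W' L := by
  induction L with
  | zero => rfl
  | succ L ih => rw [revPrefix, revPrefix, h L L.lt_succ_self, ih fun k hk => h k (by omega)]

/-- An infinite word all of whose prefixes avoid repetitions. -/
theorem exists_forall_revPrefix_mem {A : Type*} [Fintype A] {r b : ℕ} (hb : 0 < b)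
    (hA : Fintype.card A = r + 2 * b) :
    ∃ W : ℕ → A, ∀ L, revPrefix W L ∈ separatedWords A r (b ^ (r + 1)) L := by
  let _ : TopologicalSpace A := ⊥
  have : DiscreteTopology A := ⟨rfl⟩
  have : Nonempty A := Fintype.card_pos_iff.1 (by omega)
  obtain ⟨a⟩ := this
  set K : ℕ → Set (ℕ → A) := fun L => {W | revPrefix W L ∈ separatedWords A r (b ^ (r + 1)) L}
    with hK
  have hclosed : ∀ L, IsClosed (K L) := by
    intro L
    -- Membership depends on finitely many coordinates, so it is pulled back from a discrete space.
    have hKe : K L = (fun (W : ℕ → A) (k : Fin L) => W k) ⁻¹'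
        {v | revPrefix (fun k => if h : k < L then v ⟨k, h⟩ else a) L ∈
          separatedWords A r (b ^ (r + 1)) L} := by
      ext W
      simp only [hK, Set.mem_ofPred_eq, Set.mem_preimage]
      rw [revPrefix_congr (W := W)]
      intro k hk
      simp [hk]
    rw [hKe]
    exact (isClosed_discrete _).preimage (by fun_prop)
  have hne : (⋂ L, K L).Nonempty := by
    refine IsCompact.nonempty_iInter_of_sequence_nonempty_isCompact_isClosed K (fun L W hW => ?_)
      (fun L => ?_) (hclosed 0).isCompact hclosed
    · exact (tail_mem_separatedWords hW).1
    · obtain ⟨x, hx⟩ := separatedWords_nonempty hb hA L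
      have hl := length_of_mem_separatedWords hx
      refine ⟨fun k => x.getD (L - 1 - k) a, ?_⟩
      have : revPrefix (fun k => x.getD (L - 1 - k) a) L = x := by
        apply List.ext_getElem?
        intro k
        by_cases hk : k < L
        · have := getElem?_revPrefix (fun k => x.getD (L - 1 - k) a)
            (show L - 1 - k < L by omega)
          rw [show L - 1 - (L - 1 - k) = k by omega] at this
          rw [this, List.getD_eq_getElem _ _ (by omega), List.getElem?_eq_getElem (by omega)]
        · rw [List.getElem?_eq_none (by rw [length_revPrefix]; omega),
            List.getElem?_eq_none (by omega)]
      rw [hK, Set.mem_ofPred_eq, this]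
      exact hx
  obtain ⟨W, hW⟩ := hne
  exact ⟨W, fun L => Set.mem_iInter.1 hW L⟩

theorem take_revPrefix_eq {A : Type*} {W : ℕ → A} {d i j : ℕ}
    (h : ∀ k < d, W (i + k) = W (j + k)) :
    (revPrefix W (i + d)).take d = (revPrefix W (j + d)).take d := by
  induction d with
  | zero => simp
  | succ d ih =>
    rw [← add_assoc, ← add_assoc, revPrefix, revPrefix, List.take_succ_cons, List.take_succ_cons,
      h d d.lt_succ_self, ih fun k hk => h k (by omega)]

theorem ne_of_forall_revPrefix_mem {A : Type*} [Fintype A] {r N : ℕ} {W : ℕ → A}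
    (hW : ∀ L, revPrefix W L ∈ separatedWords A r N L) {i j : ℕ} (hij : i < j) (hjr : j ≤ i + r) :
    W i ≠ W j := by
  intro h
  have h1 := (tail_mem_separatedWords (hW (j + 1))).2
  apply h1
  rw [← h]
  apply List.mem_of_getElem? (i := j - 1 - i)
  rw [List.getElem?_take, if_pos (by omega), getElem?_revPrefix W hij]

theorem hasSparseWord_three {r b : ℕ} (hb : 0 < b) :
    HasSparseWord r (2 * b) 3 (b ^ (r + 1)) (r + 1) := by
  obtain ⟨W, hW⟩ := exists_forall_revPrefix_mem (A := Fin r ⊕ Fin (2 * b)) (r := r) hb (by simp)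
  refine ⟨W, fun i => ?_, fun i l h => ?_⟩
  -- The other r letters cannot fill r + 1 consecutive places with distinct letters.
  · by_contra hno
    have hl : ∀ k : Fin (r + 1), ∃ a, W (i + k) = Sum.inl a := fun k => by
      rcases hWk : W (i + k) with a | a
      · exact ⟨a, rfl⟩
      · exact absurd ⟨k, k.2, by simp [hWk]⟩ hno
    choose φ hφ using hl
    obtain ⟨x, y, hxy, he⟩ := Fintype.exists_ne_map_eq_of_card_lt φ (by simp)
    have heW : W (i + x) = W (i + y) := by rw [hφ, hφ, he]
    rcases lt_or_gt_of_ne hxy with hlt | hlt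
    · exact ne_of_forall_revPrefix_mem hW (by omega) (by omega) heW
    · exact ne_of_forall_revPrefix_mem hW (i := i + y) (j := i + x) (by omega) (by omega) heW.symm
  · obtain ⟨m, ⟨m', ⟨m'', h0, hl', -⟩, hl, heq⟩, hl3, heq3⟩ := h
    -- An instance of Z_2 repeats its first letter, which cannot happen within distance r.
    have hm : r + 1 ≤ m := by
      by_contra hlt
      exact ne_of_forall_revPrefix_mem hW (i := i) (j := i + (m - m')) (by omega) (by omega)
        (by simpa using heq 0 (by omega))
    have ht := take_revPrefix_eq (W := W) (d := r + 1) (i := i) (j := i + (l - m))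
      fun k hk => heq3 k (by omega)
    by_contra hlt
    have hmem := hW (i + (l - m) + (r + 1))
    rw [show i + (l - m) + (r + 1) = (i + (l - m) + r) + 1 by omega] at hmem
    refine (mem_separatedWords_succ.1 hmem).2 (l - m) (Finset.mem_Ico.2 ⟨by omega, by omega⟩)
      (by omega) ?_
    rw [show i + (l - m) + r + 1 = (l - m) + (i + (r + 1)) by omega, drop_revPrefix, ht]
    congr 2
    omega

theorem hasSparseWord_iterate {r b : ℕ} (hb : 0 < b) (j : ℕ) :
    HasSparseWord r (2 * b * 4 ^ j) (3 + j)
      ((fun M => 2 ^ (M / (r + 1) / 2))^[j] (b ^ (r + 1))) (r + 1) := by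
  induction j with
  | zero => simpa using hasSparseWord_three hb
  | succ j ih =>
    rw [Function.iterate_succ_apply', pow_succ, ← mul_assoc]
    exact ih.succ

theorem iterate_le_f {q r b j : ℕ} (hb : 0 < b) (hq : r + 2 * b * 4 ^ j = q) :
    (fun M => 2 ^ (M / (r + 1) / 2))^[j] (b ^ (r + 1)) ≤ f (3 + j) q := by
  obtain ⟨W, -, hM⟩ := hasSparseWord_iterate (r := r) hb j
  have φ : Fin r ⊕ Fin (2 * b * 4 ^ j) ≃ Fin q := Fintype.equivFinOfCardEq (by simp [← hq])
  refine le_f (W := fun i => φ (W i)) fun i l h => hM i l ?_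
  simpa using h.comp φ.symm

/-! ### Tower estimates -/

theorem one_le_tower {b x : ℝ} (hb : 1 ≤ b) (hx : 0 ≤ x) : ∀ k, 1 ≤ tower b x (k + 2) := by
  intro k
  induction k with
  | zero => exact Real.one_le_rpow hb hx
  | succ k ih => exact Real.one_le_rpow hb (zero_le_one.trans ih)

/-- At each level b^y b^3 = b^(y+3), and y + 3 ≤ y b^3 for y ≥ 1, so the factor b^3 is absorbed one
level higher. -/
theorem tower_mul_pow_three_le {b x : ℝ} (hb : 2 ≤ b) (hx : 0 ≤ x) (k : ℕ) :
    tower b x (k + 2) * b ^ 3 ≤ tower b (x + 3) (k + 2) := by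
  have hb0 : 0 < b := by linarith
  have hrw : ∀ y : ℝ, b ^ y * b ^ 3 = b ^ (y + 3) := fun y => by
    rw [Real.rpow_add hb0]; norm_cast
  induction k with
  | zero => exact (hrw x).le
  | succ k ih =>
    have h1 := one_le_tower (b := b) (by linarith) hx k
    have h8 : (8 : ℝ) ≤ b ^ 3 := by
      calc (8 : ℝ) = 2 ^ 3 := by norm_num
        _ ≤ b ^ 3 := by gcongr
    change b ^ tower b x (k + 2) * b ^ 3 ≤ b ^ tower b (x + 3) (k + 2)
    rw [hrw]
    apply Real.rpow_le_rpow_of_exponent_le (by linarith)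
    nlinarith

/-- Since q ≤ 2^q, an exponent of at least qt suffices; the factor q^3 pays for the divisions by g
and 2, the rounding and this change of base. -/
theorem rpow_le_two_pow {q g M : ℕ} {t : ℝ} (hq : 4 ≤ q) (hg : 0 < g) (hgq : g ≤ q) (ht : 1 ≤ t)
    (h : t * (q : ℝ) ^ 3 ≤ M) : (q : ℝ) ^ t ≤ ((2 ^ (M / g / 2) : ℕ) : ℝ) := by
  have hq' : (4 : ℝ) ≤ q := by exact_mod_cast hq
  have h1 : q * t ≤ ((M / g / 2 : ℕ) : ℝ) := by
    have hlt : M < (M / g / 2 + 1) * (2 * q) := by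
      rw [Nat.div_div_eq_div_mul]
      have h1 := Nat.lt_div_mul_add (a := M) (b := g * 2) (by omega)
      calc M < (M / (g * 2) + 1) * (g * 2) := by rw [add_mul]; omega
        _ ≤ (M / (g * 2) + 1) * (2 * q) := Nat.mul_le_mul_left _ (by omega)
    have hlt' : (M : ℝ) < (((M / g / 2 : ℕ) : ℝ) + 1) * (2 * q) := by exact_mod_cast hlt
    have h2 : t * (q : ℝ) ^ 2 < (((M / g / 2 : ℕ) : ℝ) + 1) * 2 := by
      have hq0 : (0 : ℝ) < q := by linarith
      refine lt_of_mul_lt_mul_right ?_ hq0.le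
      nlinarith
    nlinarith [mul_le_mul_of_nonneg_right hq' (by nlinarith : 0 ≤ q * t)]
  calc (q : ℝ) ^ t ≤ ((2 : ℝ) ^ (q : ℝ)) ^ t := by
        apply Real.rpow_le_rpow (by linarith) _ (by linarith)
        rw [Real.rpow_natCast]
        exact_mod_cast Nat.lt_two_pow_self.le
    _ = (2 : ℝ) ^ ((q : ℝ) * t) := by rw [Real.rpow_mul (by norm_num)]
    _ ≤ (2 : ℝ) ^ ((M / g / 2 : ℕ) : ℝ) := Real.rpow_le_rpow_of_exponent_le (by norm_num) h1
    _ = _ := by rw [Real.rpow_natCast]; norm_cast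

theorem tower_le_iterate {q g N : ℕ} {x : ℝ} (hq : 4 ≤ q) (hg : 0 < g) (hgq : g ≤ q)
    (hN : (q : ℝ) ^ x ≤ N) (j : ℕ) (hx : 3 * j ≤ x) :
    tower q (x - 3 * j) (j + 2) ≤ ((fun M => 2 ^ (M / g / 2))^[j] N : ℕ) := by
  have hq' : (4 : ℝ) ≤ q := by exact_mod_cast hq
  induction j with
  | zero => simpa [tower] using hN
  | succ j ih =>
    rw [Function.iterate_succ_apply']
    push_cast at hx
    have h0 : 0 ≤ x - 3 * ((j + 1 : ℕ) : ℝ) := by push_cast; linarith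
    refine rpow_le_two_pow hq hg hgq (one_le_tower (by linarith) h0 j) ?_
    refine (tower_mul_pow_three_le (by linarith) h0 j).trans ?_
    rw [show x - 3 * ((j + 1 : ℕ) : ℝ) + 3 = x - 3 * j by push_cast; ring]
    exact ih (by linarith)

/-! ### Asymptotic choice of parameters -/

open Filter Topology Asymptotics

/-- The number of letters used as spare choices at each step. -/
noncomputable def spare (q : ℕ) : ℕ := ⌊(q : ℝ) / Real.log q⌋₊

theorem tendsto_log_natCast_atTop : Tendsto (fun q : ℕ => Real.log q) atTop atTop :=
  Real.tendsto_log_atTop.comp tendsto_natCast_atTop_atTop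

theorem tendsto_spare_div : Tendsto (fun q : ℕ => (spare q : ℝ) / q) atTop (𝓝 0) := by
  refine squeeze_zero' (g := fun q : ℕ => (Real.log q)⁻¹) (Eventually.of_forall fun q => by positivity) ?_
    tendsto_log_natCast_atTop.inv_tendsto_atTop
  filter_upwards [eventually_gt_atTop 1] with q hq
  have hq0 : (0 : ℝ) < q := by exact_mod_cast (by omega : 0 < q)
  have hlog : 0 < Real.log q := Real.log_pos (by exact_mod_cast hq)
  rw [div_le_iff₀ hq0]
  calc (spare q : ℝ) ≤ q / Real.log q := Nat.floor_le (by positivity)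
    _ = _ := by rw [div_eq_inv_mul]

theorem eventually_div_le_spare :
    ∀ᶠ q : ℕ in atTop, (q : ℝ) / (2 * Real.log q) ≤ spare q ∧ 1 ≤ spare q := by
  have h1 : Tendsto (fun q : ℕ => Real.log q / q) atTop (𝓝 0) :=
    (Real.isLittleO_log_id_atTop.tendsto_div_nhds_zero).comp tendsto_natCast_atTop_atTop
  filter_upwards [eventually_gt_atTop 1, h1.eventually_lt_const (show (0 : ℝ) < 1 / 2 by norm_num)]
    with q hq h
  have hq0 : (0 : ℝ) < q := by exact_mod_cast (by omega : 0 < q)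
  have hlog : 0 < Real.log q := Real.log_pos (by exact_mod_cast hq)
  rw [div_lt_iff₀ hq0] at h
  have h2 : 2 ≤ (q : ℝ) / Real.log q := by rw [le_div_iff₀ hlog]; linarith
  have h3 : (q : ℝ) / Real.log q < spare q + 1 := Nat.lt_floor_add_one _
  have h4 : (q : ℝ) / (2 * Real.log q) = q / Real.log q / 2 := by rw [div_div, mul_comm 2]
  constructor
  · rw [h4]; linarith
  · exact Nat.le_floor (by push_cast; linarith)

theorem tendsto_log_spare_div :
    Tendsto (fun q : ℕ => Real.log (spare q) / Real.log q) atTop (𝓝 1) := by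
  have hlow : Tendsto (fun q : ℕ => 1 - (Real.log 2 / Real.log q +
      Real.log (Real.log q) / Real.log q)) atTop (𝓝 1) := by
    have h1 : Tendsto (fun q : ℕ => Real.log 2 / Real.log q) atTop (𝓝 0) :=
      tendsto_log_natCast_atTop.const_div_atTop _
    have h2 : Tendsto (fun q : ℕ => Real.log (Real.log q) / Real.log q) atTop (𝓝 0) :=
      (Real.isLittleO_log_id_atTop.tendsto_div_nhds_zero).comp tendsto_log_natCast_atTop
    simpa using (h1.add h2).const_sub 1
  refine tendsto_of_tendsto_of_tendsto_of_le_of_le' hlow tendsto_const_nhds ?_ ?_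
  · filter_upwards [eventually_gt_atTop 1, eventually_div_le_spare] with q hq hs
    have hq0 : (0 : ℝ) < q := by exact_mod_cast (by omega : 0 < q)
    have hlog : 0 < Real.log q := Real.log_pos (by exact_mod_cast hq)
    have h := Real.log_le_log (by positivity) hs.1
    rw [Real.log_div hq0.ne' (by positivity), Real.log_mul two_ne_zero hlog.ne'] at h
    rw [le_div_iff₀ hlog, sub_mul, add_mul, div_mul_cancel₀ _ hlog.ne',
      div_mul_cancel₀ _ hlog.ne']
    linarith
  · filter_upwards [eventually_gt_atTop 1, eventually_div_le_spare,
      tendsto_spare_div.eventually_lt_const zero_lt_one] with q hq hs hlt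
    have hq0 : (0 : ℝ) < q := by exact_mod_cast (by omega : 0 < q)
    have hlog : 0 < Real.log q := Real.log_pos (by exact_mod_cast hq)
    rw [div_lt_one hq0] at hlt
    rw [div_le_one hlog]
    exact Real.log_le_log (by exact_mod_cast hs.2) hlt.le

end ZiminWords

theorem theorem1 (n : ℕ) (hn : 3 ≤ n) :
    ∃ e : ℕ → ℝ,
      Asymptotics.IsLittleO Filter.atTop e (fun q : ℕ => (q : ℝ)) ∧
      ∀ᶠ q : ℕ in Filter.atTop,
        ZiminWords.tower (q : ℝ) ((q : ℝ) - e q) (n - 1) ≤ (ZiminWords.f n q : ℝ) := by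
  open ZiminWords Filter Topology in
  obtain ⟨j, rfl⟩ := Nat.exists_eq_add_of_le hn
  set c : ℕ := 2 * 4 ^ j with hc
  -- Chosen so that q^x = b^(r+1), with b = `spare q` and r = q - c b.
  set x : ℕ → ℝ := fun q => (q - c * spare q + 1) * (Real.log (spare q) / Real.log q) with hx
  have hq0 : ∀ᶠ q : ℕ in atTop, (q : ℝ) ≠ 0 :=
    (eventually_ne_atTop 0).mono fun q hq => by exact_mod_cast hq
  have hinv : ∀ C : ℝ, Tendsto (fun q : ℕ => C / (q : ℝ)) atTop (𝓝 0) := fun C =>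
    tendsto_natCast_atTop_atTop.const_div_atTop C
  have ho : Asymptotics.IsLittleO atTop (fun q : ℕ => (q : ℝ) - x q + 3 * j)
      (fun q : ℕ => (q : ℝ)) := by
    rw [Asymptotics.isLittleO_iff_tendsto' (hq0.mono fun q h h' => absurd h' h)]
    have h1 : Tendsto (fun q : ℕ => 1 - (1 - c * (spare q / (q : ℝ)) + 1 / q) *
        (Real.log (spare q) / Real.log q) + 3 * j / q) atTop
        (𝓝 (1 - (1 - c * 0 + 0) * 1 + 0)) :=
      ((((tendsto_spare_div.const_mul (c : ℝ)).const_sub 1).add (hinv 1)).mul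
        tendsto_log_spare_div).const_sub 1 |>.add (hinv _)
    rw [show (1 - (1 - (c : ℝ) * 0 + 0) * 1 + 0) = 0 by ring] at h1
    refine h1.congr' (hq0.mono fun q h => ?_)
    simp only [hx]
    generalize Real.log (spare q) / Real.log q = y
    field_simp
  refine ⟨fun q => (q : ℝ) - x q + 3 * j, ho, ?_⟩
  filter_upwards [eventually_ge_atTop 4, eventually_div_le_spare,
    (tendsto_spare_div.const_mul (c : ℝ)).eventually_lt_const (show (c : ℝ) * 0 < 1 by simp),
    ho.bound one_pos] with q hq4 hs hcs hbound
  have hqpos : (0 : ℝ) < q := by exact_mod_cast (by omega : 0 < q)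
  have hlog : 0 < Real.log q := Real.log_pos (by exact_mod_cast (by omega : 1 < q))
  have hcsq : c * spare q < q := by
    rw [← mul_div_assoc, div_lt_one hqpos] at hcs
    exact_mod_cast hcs
  obtain ⟨r, hr⟩ : ∃ r, r + 2 * spare q * 4 ^ j = q := by
    refine ⟨q - c * spare q, ?_⟩
    rw [show 2 * spare q * 4 ^ j = c * spare q by rw [hc]; ring]
    omega
  have hrc : r + c * spare q = q := by
    have : c * spare q = 2 * spare q * 4 ^ j := by rw [hc]; ring
    linarith
  have hrR : (r : ℝ) + c * spare q = q := by exact_mod_cast hrc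
  have hcpos : 0 < c := by positivity
  have hrq : r + 1 ≤ q := by
    have := Nat.mul_pos hcpos hs.2
    omega
  have hspos : (0 : ℝ) < spare q := by exact_mod_cast hs.2
  have hN : (q : ℝ) ^ x q ≤ ((spare q ^ (r + 1) : ℕ) : ℝ) := by
    apply le_of_eq
    rw [Real.rpow_def_of_pos hqpos]
    push_cast
    rw [← Real.rpow_natCast, Real.rpow_def_of_pos hspos]
    congr 1
    simp only [hx]
    rw [show (q : ℝ) - c * spare q + 1 = r + 1 by linarith]
    push_cast
    field_simp
  -- The little-o bound with constant 1 says that q - x + 3j ≤ q.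
  have hxj : 3 * (j : ℝ) ≤ x q := by
    rw [Real.norm_eq_abs, Real.norm_eq_abs, abs_of_pos hqpos, one_mul] at hbound
    have := (abs_le.1 hbound).2
    linarith
  have h1 := tower_le_iterate hq4 r.succ_pos hrq hN j hxj
  have h2 : _ ≤ (f (3 + j) q : ℝ) := Nat.cast_le.2 (iterate_le_f hs.2 hr)
  refine le_trans (le_of_eq ?_) (h1.trans h2)
  rw [show 3 + j - 1 = j + 2 by omega]
  congr 1
  ring
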